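/- **Setting.** Let $M,N\ge 0$, $l\ge 1$ be integers, $k,c\in\mathbb{C}$, $\varkappa=k+(l-1)(M-N)$. A parity sequence for $M|N$ is $\varsigma=(\varsigma_1,\dots,\varsigma_{M+N})$ with $\varsigma_i=\pm1$, exactly $M$ of them being $+1$; put $(-1)^{p(i)}=\varsigma_i$, $p(i)\in\mathbb{Z}/2$. Brackets are superbrackets $[u,v]=uv-(-1)^{|u||v|}vu$. *The Lie superalgebras.* $\mathfrak{gl}(Ml|Nl)$ has the basis $E_{xy}$, where $x=(r,i)$, $y=(s,j)$ with $1\le r,s\le l$ and $1\le i,j\le M+N$; write also $E_{xy}=E_{ij}\otimes E_{rs}$, $p(x)=p(i)$, $b(x)=r$. Here $E_{xy}$ has parity $|xy|=p(x)+p(y)$, and $E_{xy}E_{zw}=(-1)^{p(y)}\delta_{yz}E_{xw}$. Let $\mathfrak{b}=\mathfrak{g}_{\le0}$ be spanned by the $E_{xy}$ with $b(y)\le b(x)$ and $\mathfrak{g}_{<0}$ by those with $b(y)<b(x)$. On $\mathfrak b$ put $$\kappa(E_{i_1j_1}\otimes E_{r_1s_1},E_{i_2j_2}\otimes E_{r_2s_2})=\delta_{r_1s_2}\delta_{r_2s_1}\delta_{i_1j_2}\delta_{i_2j_1}(-1)^{p(j_1)}\varkappa+\delta_{r_1s_1}\delta_{r_2s_2}\delta_{i_1j_1}\delta_{i_2j_2}(\delta_{r_1r_2}-c).$$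 Let $\mathfrak a$ be the Lie superalgebra with basis $\mathcal A^{(u)}$ ($u$ a basis element of $\mathfrak b$, parity $|u|$) and $\mathcal A_{(v)}$ ($v$ a basis element of $\mathfrak g_{<0}$, parity $|v|+1$), with $[\mathcal A^{(u)},\mathcal A^{(u')}]=\mathcal A^{([u,u'])}$, $[\mathcal A_{(v)},\mathcal A_{(v')}]=0$, $[\mathcal A^{(u)},\mathcal A_{(v)}]=\mathcal A_{(uv-(-1)^{|u|(|v|+1)}vu)}$, and with the form $\kappa$ on the $\mathcal A^{(u)}$, extended by $0$. For $\mathfrak h=\mathfrak b,\mathfrak a$ let $V^k(\mathfrak h)$ be the universal affine vertex superalgebra: the vacuum module of $[ut^m,vt^n]=[u,v]t^{m+n}+\delta_{m,-n}m\kappa(u,v)\mathbf 1$ with $\mathbf 1=1$. Write $u[m]=ut^m$, let $\partial$ be the translation operator, and identify $V^k(\mathfrak b)$ with its image in $V^k(\mathfrak a)$ under $u\mapsto\mathcal A^{(u)}$. *The $\mathcal W$-algebra.* Let $Q$ be the unique odd derivation of $V^k(\mathfrak a)$ (that is, $Q|0\rangle=0$ and $Q(u_{(n)}v)=(Qu)_{(n)}v+(-1)^{|u|}u_{(n)}Qv$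 for all $n$) that commutes with $\partial$ and satisfies $$\begin{aligned}Q\mathcal A^{(E_{xy})}={}&\sum_{b(y)\le b(z)<b(x)}(-1)^{|xy|+|xz||zy|+p(z)}\,{:}\mathcal A^{(E_{zy})}\mathcal A_{(E_{xz})}{:}-\sum_{b(y)<b(z)\le b(x)}(-1)^{|xz||zy|+p(z)}\,{:}\mathcal A_{(E_{zy})}\mathcal A^{(E_{xz})}{:}\\&+(-1)^{p(x)}\bigl(\varkappa\,\partial\mathcal A_{(E_{xy})}+\mathcal A_{(E_{x^+y})}-\mathcal A_{(E_{xy^-})}\bigr),\\Q\mathcal A_{(E_{xy})}={}&-\sum_{b(y)<b(z)<b(x)}(-1)^{|xz||zy|+p(y)}\,{:}\mathcal A_{(E_{zy})}\mathcal A_{(E_{xz})}{:}\end{aligned}$$ where $x^{+}=(r+1,i)$ for $x=(r,i)$, $y^-=(s-1,j)$ for $y=(s,j)$, and $\mathcal A_{(E_{xy})}$ is read as $0$ if $b(y)\ge b(x)$ or an index is out of range. The rectangular $\mathcal W$-algebra is the vertex superalgebra $$\mathcal W_{M|N\times l}=\mathcal W_{M|N\times l}(\varsigma)=\{v\in V^k(\mathfrak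 b)\subset V^k(\mathfrak a)\mid Qv=0\}.$$ *The generators.* Let $t=\varkappa\tau$, with $\tau$ even, act by $tv=vt+\varkappa\,\partial v$. Let $B=(b_{rs})$ be the $l\times l$ matrix with $b_{rs}=\delta_{rs}t+E_{rs}[-1]$ for $s\le r$, $b_{r,r+1}=-1$, and $b_{rs}=0$ for $s>r+1$, and let $\operatorname{cdet}B=\sum_{\pi\in\mathfrak S_l}\operatorname{sgn}\pi\;b_{\pi(1)1}(b_{\pi(2)2}(\cdots b_{\pi(l)l}))$. Put $\mathfrak T_{ij}(E_{rs}[-1])=(E_{ji}\otimes E_{rs})[-1]$, $\mathfrak T_{ij}(t)=\delta_{ij}t$, $\mathfrak T_{ij}(1)=\delta_{ij}$, and extend linearly and by $$\mathfrak T_{ij}(xy)=\sum_h(-1)^{(p(i)+p(h))(p(h)+p(j))}\mathfrak T_{ih}(x)\mathfrak T_{hj}(y),$$ with normally ordered products in $V^k(\mathfrak b)$. Define $U^{(r)}_{ij}\in V^k(\mathfrak b)$, for $1\le r\le l$ and $1\le i,j\le M+N$, by $\mathfrak T_{ij}(\operatorname{cdet}B)=\sum_{r=0}^lU^{(r)}_{ji}\,t^{\,l-r}$.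 **Proposition.** Fix $M,N,l$ (and $k,c$). 1. For any two parity sequences $\varsigma,\varsigma'$ for $M|N$, the vertex superalgebras $\mathcal W_{M|N\times l}(\varsigma)$ and $\mathcal W_{M|N\times l}(\varsigma')$ are isomorphic. 2. More precisely, let $\sigma\in\mathfrak S_{M+N}$ satisfy $\varsigma'_{\sigma(i)}=\varsigma_i$ for all $i$; for instance, $\sigma$ may be an adjacent transposition that relates $\varsigma$ and $\varsigma'$. Then there is an isomorphism of vertex superalgebras $\mathcal W_{M|N\times l}(\varsigma)\to\mathcal W_{M|N\times l}(\varsigma')$ given by $U^{(r)}_{ij}\mapsto U^{(r)}_{\sigma(i)\sigma(j)}$ for $1\le r\le l$ and $1\le i,j\le M+N$: it is the restriction of an isomorphism of vertex superalgebras $V^k(\mathfrak b)\to V^k(\mathfrak b')$ with this effect on the $U^{(r)}_{ij}$, where $\mathfrak b,\mathfrak b'$ belong to $\varsigma,\varsigma'$. -/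

import Mathlib

noncomputable section

namespace RectW

/-! ### Vertex superalgebras: the operations, and isomorphisms -/

/-- The operations of a vertex superalgebra with state space `V`: the vacuum, the even and odd
parts `part 0`, `part 1`, and all products `u_(n) v` for `n : ℤ`, where
`Y(u, z) = ∑ u_(n) z ^ (-n-1)`. The translation operator is `∂ u = u_(-2) vac`. -/
structure VertexSuperData (V : Type) [AddCommGroup V] [Module ℂ V] where
  vac : V
  part : ZMod 2 → Submodule ℂ V
  prod : ℤ → V → V → V

/-- The translation operator `∂`. -/
def VertexSuperData.trans {V : Type} [AddCommGroup V] [Module ℂ V] (X : VertexSuperData V)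
    (u : V) : V :=
  X.prod (-2) u X.vac

/-- Isomorphisms of vertex superalgebras: even linear bijections that preserve the vacuum and
all products. -/
structure VertexSuperData.Iso {V V' : Type} [AddCommGroup V] [Module ℂ V] [AddCommGroup V']
    [Module ℂ V'] (X : VertexSuperData V) (X' : VertexSuperData V') where
  toLinearEquiv : V ≃ₗ[ℂ] V'
  map_vac : toLinearEquiv X.vac = X'.vac
  map_part : ∀ ε : ZMod 2, (X.part ε).map (toLinearEquiv : V →ₗ[ℂ] V') = X'.part ε
  map_prod : ∀ (n : ℤ) (u v : V),
    toLinearEquiv (X.prod n u v) = X'.prod n (toLinearEquiv u) (toLinearEquiv v)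

open Classical in
/-- The operations restricted to a vertex subalgebra `W`, that is, a subspace that contains the
vacuum and is closed under all products (for such a `W` the value `0` below is never used). -/
def VertexSuperData.restrict {V : Type} [AddCommGroup V] [Module ℂ V] (X : VertexSuperData V)
    (W : Submodule ℂ V) : VertexSuperData W where
  vac := if h : X.vac ∈ W then ⟨X.vac, h⟩ else 0
  part ε := (X.part ε).comap W.subtype
  prod n u v := if h : X.prod n (u : V) (v : V) ∈ W then ⟨X.prod n (u : V) (v : V), h⟩ else 0

/-- The sign `(-1) ^ x`. -/
def ksign (x : ZMod 2) : ℂ := if x = 0 then 1 else -1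

/-- The `n`-th product of two fields `A(z) = ∑ A_(m) z ^ (-m-1)` and `B(z)` of parities `εA`,
`εB`:
`(A_(n) B)_(m) v = ∑_{j ≥ 0} (-1)^j (n choose j)
  (A_(n-j) B_(m+j) v - (-1)^(n + εA εB) B_(n+m-j) A_(j) v)`,
the sum being finite for fields. For `n = -1` this is the normally ordered product. -/
def fieldProd {V : Type} [AddCommGroup V] [Module ℂ V] (εA εB : ZMod 2) (A : ℤ → V → V) (n : ℤ)
    (B : ℤ → V → V) : ℤ → V → V :=
  fun m v => ∑ᶠ j : ℕ, ((-1 : ℂ) ^ j * ((Ring.choose n j : ℤ) : ℂ)) •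
    (A (n - j) (B (m + j) v) - ((-1 : ℂ) ^ n * ksign (εA * εB)) • B (n + m - j) (A j v))

/-! ### Universal affine vertex superalgebras -/

/-- A Lie superalgebra with an invariant bilinear form, given in a homogeneous basis `B`: the
parities, the brackets of basis elements, and the form. -/
structure LieSuperData (B : Type) where
  par : B → ZMod 2
  br : B → B → (B →₀ ℂ)
  form : B → B → ℂ

variable {B : Type} {B' : Type}

/-- The relations
`[a t^m, b t^n] = [a, b] t^(m+n) + δ_{m,-n} m κ(a, b) 1` of the affinization, with the central
element set to `1`. -/
inductive AffRel (D : LieSuperData B) :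
    FreeAlgebra ℂ (B × ℤ) → FreeAlgebra ℂ (B × ℤ) → Prop
  | comm (a b : B) (m n : ℤ) :
      AffRel D
        (FreeAlgebra.ι ℂ (a, m) * FreeAlgebra.ι ℂ (b, n) -
          ksign (D.par a * D.par b) • (FreeAlgebra.ι ℂ (b, n) * FreeAlgebra.ι ℂ (a, m)))
        (((D.br a b).sum fun d r => r • FreeAlgebra.ι ℂ (d, m + n)) +
          algebraMap ℂ (FreeAlgebra ℂ (B × ℤ)) (if m + n = 0 then (m : ℂ) * D.form a b else 0))

/-- The universal enveloping algebra of the affinization modulo `1 - 1` (central element equal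
to one). -/
abbrev Aff (D : LieSuperData B) : Type := RingQuot (AffRel D)

/-- The element `b[m] = b t^m`. -/
def mode (D : LieSuperData B) (b : B) (m : ℤ) : Aff D :=
  RingQuot.mkAlgHom ℂ (AffRel D) (FreeAlgebra.ι ℂ (b, m))

/-- The left ideal generated by `b[m]` for all `b` and all `m ≥ 0`. -/
def posIdeal (D : LieSuperData B) : Submodule (Aff D) (Aff D) :=
  Submodule.span (Aff D) {x | ∃ (b : B) (m : ℤ), 0 ≤ m ∧ x = mode D b m}

/-- The vacuum module, which is the state space of the universal affine vertex superalgebra. -/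
abbrev VacMod (D : LieSuperData B) : Type := Aff D ⧸ posIdeal D

/-- The vacuum vector. -/
def vacuum (D : LieSuperData B) : VacMod D := Submodule.Quotient.mk 1

/-- `StateField D ε u A` holds when the homogeneous state `u` of parity `ε` has the field `A`:
the vacuum has the identity field, `Y(b[n] u, z) = b(z)_(n) Y(u, z)` for the generating
currents `b(z) = ∑ b[m] z ^ (-m-1)`, and `Y` is linear. -/
inductive StateField (D : LieSuperData B) :
    ZMod 2 → VacMod D → (ℤ → VacMod D → VacMod D) → Prop
  | vac : StateField D 0 (vacuum D) (fun n v => if n = -1 then v else 0)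
  | mode (b : B) (n : ℤ) {ε : ZMod 2} {u : VacMod D} {A : ℤ → VacMod D → VacMod D} :
      StateField D ε u A →
      StateField D (D.par b + ε) (mode D b n • u)
        (fieldProd (D.par b) ε (fun m v => mode D b m • v) n A)
  | add {ε : ZMod 2} {u u' : VacMod D} {A A' : ℤ → VacMod D → VacMod D} :
      StateField D ε u A → StateField D ε u' A' → StateField D ε (u + u') (A + A')
  | smul (r : ℂ) {ε : ZMod 2} {u : VacMod D} {A : ℤ → VacMod D → VacMod D} :
      StateField D ε u A → StateField D ε (r • u) (r • A)

/-- The same for states that need not be homogeneous. -/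
def IsFieldOf (D : LieSuperData B) (u : VacMod D) (A : ℤ → VacMod D → VacMod D) : Prop :=
  ∃ u₀ A₀ u₁ A₁, StateField D 0 u₀ A₀ ∧ StateField D 1 u₁ A₁ ∧ u = u₀ + u₁ ∧ A = A₀ + A₁

open Classical in
/-- The state-field correspondence: `Y(u, z)` is the unique field of `u`. (By the reconstruction
theorem, for an invariant form there is exactly one.) -/
def fieldOf (D : LieSuperData B) (u : VacMod D) : ℤ → VacMod D → VacMod D :=
  if h : ∃! A, IsFieldOf D u A then h.choose else 0

/-- The universal affine vertex superalgebra. Its part of parity `ε` is spanned by the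
`b₁[m₁] ⋯ b_q[m_q] vac` with `par b₁ + ⋯ + par b_q = ε`. -/
def affineVertex (D : LieSuperData B) : VertexSuperData (VacMod D) where
  vac := vacuum D
  part ε := Submodule.span ℂ {u | ∃ w : List (B × ℤ),
    (w.map fun x => D.par x.1).sum = ε ∧ u = (w.map fun x => mode D x.1 x.2).prod • vacuum D}
  prod n u v := fieldOf D u n v

/-- A map of bases that preserves parities, brackets and forms. -/
structure LieSuperData.Hom (D : LieSuperData B) (D' : LieSuperData B') where
  toFun : B → B'
  map_par : ∀ a, D'.par (toFun a) = D.par a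
  map_br : ∀ a b, D'.br (toFun a) (toFun b) = (D.br a b).mapDomain toFun
  map_form : ∀ a b, D'.form (toFun a) (toFun b) = D.form a b

lemma mode_comm (D : LieSuperData B) (a b : B) (m n : ℤ) :
    mode D a m * mode D b n - ksign (D.par a * D.par b) • (mode D b n * mode D a m) =
      ((D.br a b).sum fun d r => r • mode D d (m + n)) +
        algebraMap ℂ (Aff D) (if m + n = 0 then (m : ℂ) * D.form a b else 0) := by
  have h := RingQuot.mkAlgHom_rel ℂ (AffRel.comm (D := D) a b m n)
  simpa [mode, Finsupp.sum, map_sum] using h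

/-- The algebra map induced by a map of Lie superalgebras. -/
def affMap {D : LieSuperData B} {D' : LieSuperData B'} (f : D.Hom D') : Aff D →ₐ[ℂ] Aff D' :=
  RingQuot.liftAlgHom ℂ ⟨FreeAlgebra.lift ℂ fun x => mode D' (f.toFun x.1) x.2, by
    rintro _ _ ⟨a, b, m, n⟩
    have h := mode_comm D' (f.toFun a) (f.toFun b) m n
    rw [f.map_par, f.map_par, f.map_br, f.map_form,
      Finsupp.sum_mapDomain_index (by simp) (by intros; rw [add_smul])] at h
    simpa [Finsupp.sum, map_sum] using h⟩

lemma affMap_mode {D : LieSuperData B} {D' : LieSuperData B'} (f : D.Hom D') (b : B) (m : ℤ) :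
    affMap f (mode D b m) = mode D' (f.toFun b) m := by
  simp [affMap, mode]

lemma posIdeal_le {D : LieSuperData B} {D' : LieSuperData B'} (f : D.Hom D') :
    posIdeal D ≤
      (posIdeal D').comap (RingHom.toSemilinearMap (affMap f : Aff D →+* Aff D')) := by
  refine Submodule.span_le.2 ?_
  rintro _ ⟨b, m, hm, rfl⟩
  refine Submodule.subset_span ⟨f.toFun b, m, hm, ?_⟩
  exact affMap_mode f b m

/-- The induced map of vacuum modules, `b₁[m₁] ⋯ b_q[m_q] vac ↦ f(b₁)[m₁] ⋯ f(b_q)[m_q] vac`. -/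
def vacMap {D : LieSuperData B} {D' : LieSuperData B'} (f : D.Hom D') :
    VacMod D →ₗ[ℂ] VacMod D' where
  toFun := Submodule.mapQ (posIdeal D) (posIdeal D')
    (RingHom.toSemilinearMap (affMap f : Aff D →+* Aff D')) (posIdeal_le f)
  map_add' := map_add _
  map_smul' r x := by
    induction x using Submodule.Quotient.induction_on with
    | H x =>
      rw [← Submodule.Quotient.mk_smul, Submodule.mapQ_apply, Submodule.mapQ_apply,
        RingHom.id_apply, ← Submodule.Quotient.mk_smul]
      congr 1
      exact map_smul (affMap f) r x

/-! ### The Lie superalgebras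

`n = M + N` and `Idx n l` is the set of pairs (block, index in the block). The basis element
`E x y` of `gl(Ml|Nl)`, `x y : Idx n l`, is the matrix with the single entry `(-1)^p(y)` at
position `(x, y)`; with `x = (r, i)` and `y = (s, j)` it is also written `E_{ij} ⊗ E_{rs}`. -/

/-- Pairs (block, index in the block). -/
abbrev Idx (n l : ℕ) : Type := Fin l × Fin n

variable {n l : ℕ}

/-- The parity `p(x) + p(y)` of `E x y`. -/
def glPar (p : Fin n → ZMod 2) (x : Idx n l × Idx n l) : ZMod 2 := p x.1.2 + p x.2.2

/-- The product `E x y * E z w = (-1)^p(y) δ_{yz} E x w`. -/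
def glMul (p : Fin n → ZMod 2) (u v : Idx n l × Idx n l) : (Idx n l × Idx n l) →₀ ℂ :=
  if u.2 = v.1 then Finsupp.single (u.1, v.2) (ksign (p u.2.2)) else 0

/-- The superbracket `u v - (-1)^(|u||v|) v u`. -/
def glBr (p : Fin n → ZMod 2) (u v : Idx n l × Idx n l) : (Idx n l × Idx n l) →₀ ℂ :=
  glMul p u v - ksign (glPar p u * glPar p v) • glMul p v u

/-- The form `κ`: on `E_{i₁j₁} ⊗ E_{r₁s₁}` and `E_{i₂j₂} ⊗ E_{r₂s₂}` it is
`δ_{r₁s₂} δ_{r₂s₁} δ_{i₁j₂} δ_{i₂j₁} (-1)^p(j₁) ϰ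
  + δ_{r₁s₁} δ_{r₂s₂} δ_{i₁j₁} δ_{i₂j₂} (δ_{r₁r₂} - c)`. -/
def kappaForm (p : Fin n → ZMod 2) (ϰ c : ℂ) (u v : Idx n l × Idx n l) : ℂ :=
  (if u.1 = v.2 ∧ v.1 = u.2 then ksign (p u.2.2) * ϰ else 0) +
    (if u.1 = u.2 ∧ v.1 = v.2 then (if u.1.1 = v.1.1 then 1 else 0) - c else 0)

/-- The basis of `𝔟 = 𝔤_{≤ 0}`: the `E_{ij} ⊗ E_{rs}` with `s ≤ r`. -/
abbrev BBasis (n l : ℕ) : Type := {x : Idx n l × Idx n l // x.2.1 ≤ x.1.1}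

/-- The basis of `𝔤_{< 0}`: the `E_{ij} ⊗ E_{rs}` with `s < r`. -/
abbrev NBasis (n l : ℕ) : Type := {x : Idx n l × Idx n l // x.2.1 < x.1.1}

/-- The Lie superalgebra `𝔟` with the form `κ`. (The brackets of elements of `𝔟` are supported
in `𝔟`, so that `subtypeDomain` loses nothing.) -/
def bData (p : Fin n → ZMod 2) (l : ℕ) (ϰ c : ℂ) : LieSuperData (BBasis n l) where
  par x := glPar p x.1
  br x y := (glBr p x.1 y.1).subtypeDomain _
  form x y := kappaForm p ϰ c x.1 y.1

/-- The bracket `[𝒜^(u), 𝒜_(v)]` for `u` in `𝔟` and `v` in `𝔤_{< 0}`. -/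
def mixedBr (p : Fin n → ZMod 2) (u : BBasis n l) (v : NBasis n l) : NBasis n l →₀ ℂ :=
  (glMul p u.1 v.1 - ksign (glPar p u.1 * (glPar p v.1 + 1)) • glMul p v.1 u.1).subtypeDomain _

/-- The Lie superalgebra `𝔞` with its form: the basis consists of the elements
`𝒜^(u) = inl u`, `u` in `𝔟`, of parity `|u|`, and `𝒜_(v) = inr v`, `v` in `𝔤_{< 0}`, of parity
`|v| + 1`. -/
def aData (p : Fin n → ZMod 2) (l : ℕ) (ϰ c : ℂ) :
    LieSuperData (BBasis n l ⊕ NBasis n l) where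
  par
    | .inl u => glPar p u.1
    | .inr v => glPar p v.1 + 1
  br
    | .inl u, .inl v => ((bData p l ϰ c).br u v).mapDomain Sum.inl
    | .inl u, .inr v => (mixedBr p u v).mapDomain Sum.inr
    | .inr v, .inl u =>
        -(ksign ((glPar p v.1 + 1) * glPar p u.1) • (mixedBr p u v).mapDomain Sum.inr)
    | .inr _, .inr _ => 0
  form
    | .inl u, .inl v => kappaForm p ϰ c u.1 v.1
    | _, _ => 0

/-- The inclusion of `𝔟` into `𝔞`. -/
def incl (p : Fin n → ZMod 2) (l : ℕ) (ϰ c : ℂ) : (bData p l ϰ c).Hom (aData p l ϰ c) where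
  toFun := Sum.inl
  map_par _ := rfl
  map_br _ _ := rfl
  map_form _ _ := rfl

/-! ### The BRST differential and the W-algebra -/

/-- The mode `E x y [m]` in the enveloping algebra for `𝔟`; zero when `E x y` is not in `𝔟`. -/
def bMode (p : Fin n → ZMod 2) (l : ℕ) (ϰ c : ℂ) (x y : Idx n l) (m : ℤ) :
    Aff (bData p l ϰ c) :=
  if h : y.1 ≤ x.1 then mode (bData p l ϰ c) ⟨(x, y), h⟩ m else 0

/-- The mode `𝒜^(E x y)[m]` in the enveloping algebra for `𝔞`; zero when `E x y` is not in
`𝔟`. -/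
def eMode (p : Fin n → ZMod 2) (l : ℕ) (ϰ c : ℂ) (x y : Idx n l) (m : ℤ) :
    Aff (aData p l ϰ c) :=
  if h : y.1 ≤ x.1 then mode (aData p l ϰ c) (.inl ⟨(x, y), h⟩) m else 0

/-- The mode `𝒜_(E x y)[m]` in the enveloping algebra for `𝔞`; zero when `E x y` is not in
`𝔤_{< 0}`. -/
def ghostMode (p : Fin n → ZMod 2) (l : ℕ) (ϰ c : ℂ) (x y : Idx n l) (m : ℤ) :
    Aff (aData p l ϰ c) :=
  if h : y.1 < x.1 then mode (aData p l ϰ c) (.inr ⟨(x, y), h⟩) m else 0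

/-- The value of the BRST differential on the generators. With `|x y| = p(x) + p(y)`, and with
`x⁺` the index `x` moved to the next block and `y⁻` the index `y` moved to the preceding block
(terms outside `𝔟` or `𝔤_{< 0}` being dropped),
`Q 𝒜^(E x y) = ∑_z (-1)^(|xy| + |xz||zy| + p(z)) :𝒜^(E z y) 𝒜_(E x z):
  - ∑_z (-1)^(|xz||zy| + p(z)) :𝒜_(E z y) 𝒜^(E x z):
  + (-1)^p(x) (ϰ ∂ 𝒜_(E x y) + 𝒜_(E x⁺ y) - 𝒜_(E x y⁻))` and
`Q 𝒜_(E x y) = - ∑_z (-1)^(|xz||zy| + p(y)) :𝒜_(E z y) 𝒜_(E x z):`. The two linear terms come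
from the nilpotent element, the identity of `gl(M|N)` tensored with the subdiagonal shift. -/
def brstGen (p : Fin n → ZMod 2) (l : ℕ) (ϰ c : ℂ) :
    BBasis n l ⊕ NBasis n l → VacMod (aData p l ϰ c)
  | .inl ⟨(x, y), _⟩ =>
      ((∑ z : Idx n l, ksign (glPar p (x, y) + glPar p (x, z) * glPar p (z, y) + p z.2) •
            (eMode p l ϰ c z y (-1) * ghostMode p l ϰ c x z (-1)))
        - (∑ z : Idx n l, ksign (glPar p (x, z) * glPar p (z, y) + p z.2) •
            (ghostMode p l ϰ c z y (-1) * eMode p l ϰ c x z (-1)))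
        + ksign (p x.2) •
            (ϰ • ghostMode p l ϰ c x y (-2)
              + (∑ r : Fin l,
                  if (r : ℕ) = x.1 + 1 then ghostMode p l ϰ c (r, x.2) y (-1) else 0)
              - (∑ s : Fin l,
                  if (s : ℕ) + 1 = y.1 then ghostMode p l ϰ c x (s, y.2) (-1) else 0))) •
        vacuum (aData p l ϰ c)
  | .inr ⟨(x, y), _⟩ =>
      (-(∑ z : Idx n l, ksign (glPar p (x, z) * glPar p (z, y) + p y.2) •
            (ghostMode p l ϰ c z y (-1) * ghostMode p l ϰ c x z (-1)))) •
        vacuum (aData p l ϰ c)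

/-- `Q` is an odd derivation of the vertex superalgebra of `𝔞`, commutes with the translation
operator, and has the prescribed values on the generators. -/
structure IsBRST (p : Fin n → ZMod 2) (l : ℕ) (ϰ c : ℂ)
    (Q : VacMod (aData p l ϰ c) →ₗ[ℂ] VacMod (aData p l ϰ c)) : Prop where
  map_vac : Q (vacuum _) = 0
  odd : ∀ ε : ZMod 2, ((affineVertex (aData p l ϰ c)).part ε).map Q ≤
    (affineVertex (aData p l ϰ c)).part (ε + 1)
  map_trans : ∀ u, Q ((affineVertex (aData p l ϰ c)).trans u) =
    (affineVertex (aData p l ϰ c)).trans (Q u)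
  leibniz : ∀ (ε : ZMod 2) (m : ℤ) (u v : VacMod (aData p l ϰ c)),
    u ∈ (affineVertex (aData p l ϰ c)).part ε →
    Q ((affineVertex (aData p l ϰ c)).prod m u v) =
      (affineVertex (aData p l ϰ c)).prod m (Q u) v +
        ksign ε • (affineVertex (aData p l ϰ c)).prod m u (Q v)
  map_gen : ∀ b, Q (mode (aData p l ϰ c) b (-1) • vacuum _) = brstGen p l ϰ c b

open Classical in
/-- The BRST differential, the unique operator with these properties. -/
def brst (p : Fin n → ZMod 2) (l : ℕ) (ϰ c : ℂ) :
    VacMod (aData p l ϰ c) →ₗ[ℂ] VacMod (aData p l ϰ c) :=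
  if h : ∃! Q, IsBRST p l ϰ c Q then h.choose else 0

/-- The elements of the vertex superalgebra of `𝔟` that are annihilated by the BRST differential
in the vertex superalgebra of `𝔞`. -/
def wSub (p : Fin n → ZMod 2) (l : ℕ) (ϰ c : ℂ) : Submodule ℂ (VacMod (bData p l ϰ c)) :=
  LinearMap.ker (brst p l ϰ c ∘ₗ vacMap (incl p l ϰ c))

/-! ### The generators -/

/-- Left multiplication by `t = ϰ τ`, where `[τ, y[m]] = - m y[m-1]`, on polynomials in `t` with
coefficients in the vertex superalgebra of `𝔟` written on the left; such a polynomial is given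
by its sequence of coefficients. That is, `t (v t^d) = v t^(d+1) + ϰ (∂ v) t^d`. -/
def tauMul (p : Fin n → ZMod 2) (l : ℕ) (ϰ c : ℂ) (P : ℕ → VacMod (bData p l ϰ c)) :
    ℕ → VacMod (bData p l ϰ c)
  | 0 => ϰ • (affineVertex (bData p l ϰ c)).trans (P 0)
  | d + 1 => P d + ϰ • (affineVertex (bData p l ϰ c)).trans (P (d + 1))

/-- Left multiplication by the component `𝔗_{ij}(b_{rs})`, where `𝔗_{ij}(x) = x ⊗ E_{ji}` and
`𝔗_{ij}(τ) = δ_{ij} τ`, `𝔗_{ij}(1) = δ_{ij}`, of the entry `b_{rs}` of the `l × l` matrix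
that has `δ_{rs} ϰ τ + E_{rs}[-1]` for `s ≤ r`, `-1` for `s = r + 1` and `0` for `s > r + 1`. -/
def entryMul (p : Fin n → ZMod 2) (l : ℕ) (ϰ c : ℂ) (i j : Fin n) (r s : Fin l)
    (P : ℕ → VacMod (bData p l ϰ c)) : ℕ → VacMod (bData p l ϰ c) :=
  fun d => bMode p l ϰ c (r, j) (s, i) (-1) • P d
    + (if r = s ∧ i = j then tauMul p l ϰ c P d else 0)
    - (if (s : ℕ) = r + 1 ∧ i = j then P d else 0)

/-- The component `𝔗_{ij}` of the product `b_{σ(s₁) s₁} (b_{σ(s₂) s₂} (⋯))` over a list of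
columns, where `𝔗_{ij}(x y) = ∑_h (-1)^((p(i) + p(h)) (p(h) + p(j))) 𝔗_{ih}(x) 𝔗_{hj}(y)`. -/
def colProd (p : Fin n → ZMod 2) (l : ℕ) (ϰ c : ℂ) (σ : Equiv.Perm (Fin l)) :
    List (Fin l) → Fin n → Fin n → ℕ → VacMod (bData p l ϰ c)
  | [], i, j => fun d => if i = j ∧ d = 0 then vacuum _ else 0
  | s :: ss, i, j => fun d => ∑ h : Fin n, ksign ((p i + p h) * (p h + p j)) •
      entryMul p l ϰ c i h (σ s) s (colProd p l ϰ c σ ss h j) d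

/-- The coefficient of `(ϰ τ)^d` in the component `𝔗_{ij}` of the column determinant. -/
def cdet (p : Fin n → ZMod 2) (l : ℕ) (ϰ c : ℂ) (i j : Fin n) (d : ℕ) :
    VacMod (bData p l ϰ c) :=
  ∑ σ : Equiv.Perm (Fin l),
    ((Equiv.Perm.sign σ : ℤ) : ℂ) • colProd p l ϰ c σ (List.finRange l) i j d

/-! ### The objects for a parity sequence -/

/-- A parity sequence for `M|N`: a sequence of `M + N` signs, `M` of which are `+1`. -/
def IsParitySeq (M N : ℕ) (ς : Fin (M + N) → ℤˣ) : Prop :=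
  (Finset.univ.filter fun i => ς i = 1).card = M

/-- The parity `p(i)`, with `(-1)^p(i) = ς_i`. -/
def parity {n : ℕ} (ς : Fin n → ℤˣ) (i : Fin n) : ZMod 2 := if ς i = 1 then 0 else 1

/-- `ϰ = k + (l - 1) (M - N)`. -/
def kappaConst (M N l : ℕ) (k : ℂ) : ℂ := k + ((l : ℂ) - 1) * ((M : ℂ) - (N : ℂ))

/-- The state space of `V^k(𝔟)`. -/
abbrev VB (M N l : ℕ) (k c : ℂ) (ς : Fin (M + N) → ℤˣ) : Type :=
  VacMod (bData (parity ς) l (kappaConst M N l k) c)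

/-- The vertex superalgebra `V^k(𝔟)`. -/
def vertexB (M N l : ℕ) (k c : ℂ) (ς : Fin (M + N) → ℤˣ) :
    VertexSuperData (VB M N l k c ς) :=
  affineVertex (bData (parity ς) l (kappaConst M N l k) c)

/-- The subspace of `V^k(𝔟)` underlying the rectangular W-algebra. -/
def wSpace (M N l : ℕ) (k c : ℂ) (ς : Fin (M + N) → ℤˣ) : Submodule ℂ (VB M N l k c ς) :=
  wSub (parity ς) l (kappaConst M N l k) c

/-- The rectangular W-algebra, a vertex subalgebra of `V^k(𝔟)`. -/
def wAlgebra (M N l : ℕ) (k c : ℂ) (ς : Fin (M + N) → ℤˣ) :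
    VertexSuperData (wSpace M N l k c ς) :=
  (vertexB M N l k c ς).restrict (wSpace M N l k c ς)

/-- The generator `U^(r)_{ij}`, defined for `r ≤ l` by
`𝔗_{ij}(cdet) = ∑_r U^(r)_{ji} (ϰ τ)^(l - r)`. -/
def wGen (M N l : ℕ) (k c : ℂ) (ς : Fin (M + N) → ℤˣ) (r : ℕ) (i j : Fin (M + N)) :
    VB M N l k c ς :=
  cdet (parity ς) l (kappaConst M N l k) c j i (l - r)

end RectW

end

noncomputable section

namespace RectW

/-! ### Transport of the universal affine vertex superalgebra -/

section Affine

variable {B B' B'' : Type} {D : LieSuperData B} {D' : LieSuperData B'} {D'' : LieSuperData B''}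

/-! The indices inside the blocks enter all the definitions only through their parities and through
equality of indices, never through their order. If `ς' (σ i) = ς i`, then applying `σ` inside each
block, with the blocks fixed, sends `E_{ij} ⊗ E_{rs}` to `E_{σ(i)σ(j)} ⊗ E_{rs}`. This preserves
parities, products and `κ`; it respects `𝔟`, `𝔤_{< 0}` and the block shifts `x⁺`, `y⁻`. The constant
`ϰ` depends on `M, N, l, k` and not on the order of the signs. So relabelling gives isomorphisms for
`𝔟` and `𝔞` (`bIso`, `aIso`), hence isomorphisms of the affine vertex superalgebras (`affineIso`).

The isomorphism for `𝔞` matches the prescribed values of the differential on generators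
(`brstGen_relabel`), so it conjugates one differential into the other (`brst_relabel`). It also
extends the one for `𝔟`, which therefore identifies the two kernels (`mem_wSub_relabel`). In the
column determinant only the summed inner index is renamed (`cdet_relabel`). Two parity sequences
with the same number of `+1` are always related by some `σ` (`exists_perm_of_isParitySeq`).

The field of a state and the differential are defined by unique existence, with value 0 otherwise.
Unique existence is itself transported in both directions, so the argument needs neither the
reconstruction theorem nor the existence of the differential. -/

lemma affMap_affMap (g : D'.Hom D'') (f : D.Hom D') (h : D.Hom D'')
    (hfg : ∀ b, g.toFun (f.toFun b) = h.toFun b) (a : Aff D) :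
    affMap g (affMap f a) = affMap h a := by
  have key : ((affMap g).comp (affMap f)) = affMap h := by
    apply RingQuot.ringQuot_ext'
    apply FreeAlgebra.hom_ext
    funext x
    change affMap g (affMap f (mode D x.1 x.2)) = affMap h (mode D x.1 x.2)
    rw [affMap_mode, affMap_mode, affMap_mode, hfg]
  exact DFunLike.congr_fun key a

lemma vacMap_mk (f : D.Hom D') (a : Aff D) :
    vacMap f (Submodule.Quotient.mk a) = Submodule.Quotient.mk (affMap f a) := rfl

@[simp] lemma vacMap_vacuum (f : D.Hom D') : vacMap f (vacuum D) = vacuum D' := by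
  rw [vacuum, vacMap_mk, map_one]; rfl

@[simp] lemma vacMap_smul_aff (f : D.Hom D') (a : Aff D) (v : VacMod D) :
    vacMap f (a • v) = affMap f a • vacMap f v := by
  induction v using Submodule.Quotient.induction_on with
  | H x =>
    rw [← Submodule.Quotient.mk_smul, vacMap_mk, vacMap_mk, ← Submodule.Quotient.mk_smul,
      smul_eq_mul, smul_eq_mul, map_mul]

/-- Allowing any `h` that agrees with the composite on basis elements lets one statement serve both
for inverse maps (`h` the identity) and for commutative squares (both paths compared with a common
diagonal). -/
lemma vacMap_vacMap (g : D'.Hom D'') (f : D.Hom D') (h : D.Hom D'')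
    (hfg : ∀ b, g.toFun (f.toFun b) = h.toFun b) (v : VacMod D) :
    vacMap g (vacMap f v) = vacMap h v := by
  induction v using Submodule.Quotient.induction_on with
  | H x => rw [vacMap_mk, vacMap_mk, vacMap_mk, affMap_affMap g f h hfg]

/-- The identity map of bases. -/
def LieSuperData.Hom.id (D : LieSuperData B) : D.Hom D where
  toFun b := b
  map_par _ := rfl
  map_br a b := (Finsupp.mapDomain_id (v := D.br a b)).symm
  map_form _ _ := rfl

lemma affMap_id (a : Aff D) : affMap (LieSuperData.Hom.id D) a = a := by
  have key : affMap (LieSuperData.Hom.id D) = AlgHom.id ℂ (Aff D) := by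
    apply RingQuot.ringQuot_ext'
    apply FreeAlgebra.hom_ext
    funext x
    exact affMap_mode (LieSuperData.Hom.id D) x.1 x.2
  exact DFunLike.congr_fun key a

lemma vacMap_id (v : VacMod D) : vacMap (LieSuperData.Hom.id D) v = v := by
  induction v using Submodule.Quotient.induction_on with
  | H x => rw [vacMap_mk, affMap_id]

/-- Bijections of bases that preserve parities, brackets and forms. -/
structure LieSuperData.Iso (D : LieSuperData B) (D' : LieSuperData B') extends B ≃ B' where
  map_par : ∀ a, D'.par (toFun a) = D.par a
  map_br : ∀ a b, D'.br (toFun a) (toFun b) = (D.br a b).mapDomain toFun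
  map_form : ∀ a b, D'.form (toFun a) (toFun b) = D.form a b

/-- The underlying map of bases. -/
def LieSuperData.Iso.hom (e : D.Iso D') : D.Hom D' where
  toFun := e.toFun
  map_par := e.map_par
  map_br := e.map_br
  map_form := e.map_form

/-- The inverse bijection. -/
def LieSuperData.Iso.symm (e : D.Iso D') : D'.Iso D where
  toEquiv := e.toEquiv.symm
  map_par a := by
    have h := e.map_par (e.toEquiv.symm a)
    rw [show e.toFun (e.toEquiv.symm a) = a from e.toEquiv.apply_symm_apply a] at h
    exact h.symm
  map_br a b := by
    have h := e.map_br (e.toEquiv.symm a) (e.toEquiv.symm b)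
    rw [show e.toFun (e.toEquiv.symm a) = a from e.toEquiv.apply_symm_apply a,
      show e.toFun (e.toEquiv.symm b) = b from e.toEquiv.apply_symm_apply b] at h
    rw [h, ← Finsupp.mapDomain_comp,
      show (e.toEquiv.symm.toFun ∘ e.toFun) = _root_.id from
        funext e.toEquiv.symm_apply_apply, Finsupp.mapDomain_id]
    rfl
  map_form a b := by
    have h := e.map_form (e.toEquiv.symm a) (e.toEquiv.symm b)
    rw [show e.toFun (e.toEquiv.symm a) = a from e.toEquiv.apply_symm_apply a,
      show e.toFun (e.toEquiv.symm b) = b from e.toEquiv.apply_symm_apply b] at h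
    exact h.symm

/-- The induced bijection of vacuum modules. -/
def vacEquiv (e : D.Iso D') : VacMod D ≃ₗ[ℂ] VacMod D' :=
  LinearEquiv.ofLinearMap (vacMap e.hom) (vacMap e.symm.hom)
    (LinearMap.ext fun v => (vacMap_vacMap e.hom e.symm.hom (LieSuperData.Hom.id D')
      e.toEquiv.apply_symm_apply v).trans (vacMap_id v))
    (LinearMap.ext fun v => (vacMap_vacMap e.symm.hom e.hom (LieSuperData.Hom.id D)
      e.toEquiv.symm_apply_apply v).trans (vacMap_id v))

lemma vacEquiv_apply (e : D.Iso D') (v : VacMod D) : vacEquiv e v = vacMap e.hom v := rfl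

lemma vacEquiv_symm (e : D.Iso D') : (vacEquiv e).symm = vacEquiv e.symm := rfl

@[simp] lemma vacEquiv_vacuum (e : D.Iso D') : vacEquiv e (vacuum D) = vacuum D' :=
  vacMap_vacuum e.hom

lemma vacEquiv_mode (e : D.Iso D') (b : B) (m : ℤ) (v : VacMod D) :
    vacEquiv e (mode D b m • v) = mode D' (e.toEquiv b) m • vacEquiv e v := by
  rw [vacEquiv_apply, vacMap_smul_aff, affMap_mode]; rfl

lemma vacEquiv_symm_mode (e : D.Iso D') (b : B) (m : ℤ) (v : VacMod D') :
    vacEquiv e (mode D b m • (vacEquiv e).symm v) = mode D' (e.toEquiv b) m • v := by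
  rw [vacEquiv_mode, LinearEquiv.apply_symm_apply]

/-! ### Transport of fields and products -/

/-- Conjugation of a field by a linear bijection. -/
def conjField {V V' : Type} [AddCommGroup V] [Module ℂ V] [AddCommGroup V'] [Module ℂ V']
    (e : V ≃ₗ[ℂ] V') (A : ℤ → V → V) : ℤ → V' → V' :=
  fun m v => e (A m (e.symm v))

lemma conjField_fieldProd {V V' : Type} [AddCommGroup V] [Module ℂ V] [AddCommGroup V']
    [Module ℂ V'] (e : V ≃ₗ[ℂ] V') (ε ε' : ZMod 2) (A C : ℤ → V → V) (n : ℤ) :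
    conjField e (fieldProd ε ε' A n C) =
      fieldProd ε ε' (conjField e A) n (conjField e C) := by
  funext m v
  simp only [conjField, fieldProd]
  -- An additive bijection preserves the support of the summands, so it commutes with `∑ᶠ` even when
  -- the support is infinite and both sums are 0 by default. Hence no finiteness of the fields is
  -- required.
  rw [show e (∑ᶠ j : ℕ, ((-1 : ℂ) ^ j * ((Ring.choose n j : ℤ) : ℂ)) •
      (A (n - j) (C (m + j) (e.symm v)) -
        ((-1 : ℂ) ^ n * ksign (ε * ε')) • C (n + m - j) (A j (e.symm v)))) = _ from
      e.toAddEquiv.map_finsum _]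
  refine finsum_congr fun j => ?_
  simp [map_sub, map_smul]

/-- Induction on the construction of the field: `vacEquiv e` intertwines the generating currents of
`b` and `e b`, and conjugation commutes with `fieldProd` and with linear combinations. -/
lemma StateField.map (e : D.Iso D') {ε : ZMod 2} {u : VacMod D} {A : ℤ → VacMod D → VacMod D}
    (h : StateField D ε u A) :
    StateField D' ε (vacEquiv e u) (conjField (vacEquiv e) A) := by
  induction h with
  | vac =>
    convert StateField.vac (D := D') using 1
    · exact vacEquiv_vacuum e
    · funext n v
      by_cases hn : n = -1 <;> simp [conjField, hn]
  | @mode b n ε u A _ ih =>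
    have h := StateField.mode (e.toEquiv b) n ih
    rw [show D'.par (e.toEquiv b) = D.par b from e.map_par b] at h
    rw [vacEquiv_mode, conjField_fieldProd]
    convert h using 2
    funext m v
    exact vacEquiv_symm_mode e b m v
  | add _ _ ih ih' =>
    convert StateField.add ih ih' using 1
    · exact map_add _ _ _
    · funext m v
      simp [conjField]
  | smul r _ ih =>
    convert StateField.smul r ih using 1
    · exact map_smul _ _ _
    · funext m v
      simp [conjField]

lemma IsFieldOf.map (e : D.Iso D') {u : VacMod D} {A : ℤ → VacMod D → VacMod D}
    (h : IsFieldOf D u A) : IsFieldOf D' (vacEquiv e u) (conjField (vacEquiv e) A) := by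
  obtain ⟨u₀, A₀, u₁, A₁, h₀, h₁, rfl, rfl⟩ := h
  refine ⟨_, _, _, _, h₀.map e, h₁.map e, map_add _ _ _, ?_⟩
  funext m v
  simp [conjField]

lemma IsFieldOf.of_map (e : D.Iso D') {u : VacMod D} {A : ℤ → VacMod D' → VacMod D'}
    (h : IsFieldOf D' (vacEquiv e u) A) : IsFieldOf D u (conjField (vacEquiv e).symm A) := by
  have h' := h.map e.symm
  rwa [← vacEquiv_symm, LinearEquiv.symm_apply_apply] at h'

lemma existsUnique_isFieldOf (e : D.Iso D') {u : VacMod D} (h : ∃! A, IsFieldOf D u A) :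
    ∃! A, IsFieldOf D' (vacEquiv e u) A := by
  obtain ⟨A, hA, hu⟩ := h
  refine ⟨_, hA.map e, fun A' hA' => ?_⟩
  rw [← hu _ (IsFieldOf.of_map e hA')]
  funext m v
  simp [conjField]

/-- Both directions matter: they ensure that `fieldOf` takes its default value for a state exactly
when it does for the image of that state. -/
lemma existsUnique_isFieldOf_iff (e : D.Iso D') (u : VacMod D) :
    (∃! A, IsFieldOf D' (vacEquiv e u) A) ↔ ∃! A, IsFieldOf D u A := by
  refine ⟨fun h => ?_, existsUnique_isFieldOf e⟩
  have h' := existsUnique_isFieldOf e.symm h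
  rwa [← vacEquiv_symm, LinearEquiv.symm_apply_apply] at h'

lemma fieldOf_vacEquiv (e : D.Iso D') (u : VacMod D) :
    fieldOf D' (vacEquiv e u) = conjField (vacEquiv e) (fieldOf D u) := by
  by_cases h : ∃! A, IsFieldOf D u A
  · have h' := existsUnique_isFieldOf e h
    rw [fieldOf, dif_pos h', fieldOf, dif_pos h]
    exact h'.unique h'.choose_spec.1 (h.choose_spec.1.map e)
  · rw [fieldOf, dif_neg (mt (existsUnique_isFieldOf_iff e u).1 h), fieldOf, dif_neg h]
    funext m v
    simp [conjField]

lemma vacEquiv_prod (e : D.Iso D') (n : ℤ) (u v : VacMod D) :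
    vacEquiv e ((affineVertex D).prod n u v) =
      (affineVertex D').prod n (vacEquiv e u) (vacEquiv e v) := by
  change vacEquiv e (fieldOf D u n v) = fieldOf D' (vacEquiv e u) n (vacEquiv e v)
  rw [fieldOf_vacEquiv, conjField, LinearEquiv.symm_apply_apply]

lemma vacEquiv_trans (e : D.Iso D') (u : VacMod D) :
    vacEquiv e ((affineVertex D).trans u) = (affineVertex D').trans (vacEquiv e u) := by
  refine (vacEquiv_prod e (-2) u (vacuum D)).trans ?_
  rw [vacEquiv_vacuum]
  rfl

/-! ### Parity parts, and restriction to subspaces -/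

lemma affMap_word (f : D.Hom D') (w : List (B × ℤ)) :
    affMap f (w.map fun x => mode D x.1 x.2).prod =
      ((w.map fun x => (f.toFun x.1, x.2)).map fun x => mode D' x.1 x.2).prod := by
  rw [map_list_prod, List.map_map, List.map_map]
  congr 1
  exact List.map_congr_left fun x _ => affMap_mode f x.1 x.2

/-- Words in the modes go to words with the same letterwise parities. For an isomorphism, applying
this to the inverse as well gives equality of the parts. -/
lemma map_part_le (f : D.Hom D') (ε : ZMod 2) :
    ((affineVertex D).part ε).map (vacMap f) ≤ (affineVertex D').part ε := by
  rw [Submodule.map_le_iff_le_comap]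
  refine Submodule.span_le.2 ?_
  rintro _ ⟨w, hw, rfl⟩
  refine Submodule.subset_span ⟨w.map fun x => (f.toFun x.1, x.2), ?_, ?_⟩
  · rw [List.map_map, ← hw]
    congr 1
    exact List.map_congr_left fun x _ => f.map_par x.1
  · rw [vacMap_smul_aff, vacMap_vacuum, affMap_word]

lemma map_part_vacEquiv (e : D.Iso D') (ε : ZMod 2) :
    ((affineVertex D).part ε).map (vacEquiv e : VacMod D →ₗ[ℂ] VacMod D') =
      (affineVertex D').part ε := by
  refine le_antisymm (map_part_le e.hom ε) fun v hv => ?_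
  exact ⟨(vacEquiv e).symm v, map_part_le e.symm.hom ε ⟨v, hv, rfl⟩,
    (vacEquiv e).apply_symm_apply v⟩

lemma vacEquiv_mem_part (e : D.Iso D') {ε : ZMod 2} {v : VacMod D} :
    vacEquiv e v ∈ (affineVertex D').part ε ↔ v ∈ (affineVertex D).part ε := by
  rw [← map_part_vacEquiv e ε]
  rw [Submodule.mem_map_equiv, LinearEquiv.symm_apply_apply]

/-- The induced isomorphism of universal affine vertex superalgebras. -/
def affineIso (e : D.Iso D') : (affineVertex D).Iso (affineVertex D') where
  toLinearEquiv := vacEquiv e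
  map_vac := vacEquiv_vacuum e
  map_part := map_part_vacEquiv e
  map_prod := vacEquiv_prod e

end Affine

lemma conj_symm_conj {V V' : Type} [AddCommGroup V] [Module ℂ V] [AddCommGroup V'] [Module ℂ V']
    (e : V ≃ₗ[ℂ] V') (Q : V →ₗ[ℂ] V) : e.symm.conj (e.conj Q) = Q := by
  ext v
  simp

/-- The restriction of an isomorphism to subspaces that correspond to each other. -/
def VertexSuperData.Iso.restrict {V V' : Type} [AddCommGroup V] [Module ℂ V] [AddCommGroup V']
    [Module ℂ V'] {X : VertexSuperData V} {X' : VertexSuperData V'} (Φ : X.Iso X')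
    (W : Submodule ℂ V) (W' : Submodule ℂ V') (h : ∀ v, Φ.toLinearEquiv v ∈ W' ↔ v ∈ W) :
    (X.restrict W).Iso (X'.restrict W') where
  toLinearEquiv := Φ.toLinearEquiv.ofSubmodules W W' (by
    ext v
    rw [Submodule.mem_map_equiv, ← h, LinearEquiv.apply_symm_apply])
  map_vac := by
    apply Subtype.ext
    -- `restrict` returns 0 when the value leaves the subspace. By `h` this happens on both sides at
    -- once, so `W` need not be known to be a vertex subalgebra.
    have hv := h X.vac
    rw [Φ.map_vac] at hv
    by_cases hW : X.vac ∈ W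
    · have hW' := hv.2 hW
      simp [VertexSuperData.restrict, hW, hW', Φ.map_vac]
    · have hW' := mt hv.1 hW
      simp [VertexSuperData.restrict, hW, hW']
  map_part ε := by
    ext w
    rw [Submodule.mem_map_equiv]
    change Φ.toLinearEquiv.symm (w : V') ∈ X.part ε ↔ (w : V') ∈ X'.part ε
    rw [← Φ.map_part ε, Submodule.mem_map_equiv]
  map_prod n u v := by
    apply Subtype.ext
    have hv := h (X.prod n u v)
    rw [Φ.map_prod] at hv
    by_cases hW : X.prod n (u : V) (v : V) ∈ W
    · have hW' := hv.2 hW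
      simp [VertexSuperData.restrict, hW, hW', Φ.map_prod]
    · have hW' := mt hv.1 hW
      simp [VertexSuperData.restrict, hW, hW']

/-! ### Relabelling the indices -/

section Relabel

variable {n : ℕ} {p p' : Fin n → ZMod 2} {σ : Equiv.Perm (Fin n)}

/-- The relabelling of the indices inside the blocks. -/
def idxEquiv (l : ℕ) (σ : Equiv.Perm (Fin n)) : Idx n l ≃ Idx n l :=
  (Equiv.refl _).prodCongr σ

@[simp] lemma idxEquiv_fst {l : ℕ} (x : Idx n l) : (idxEquiv l σ x).1 = x.1 := rfl

@[simp] lemma idxEquiv_snd {l : ℕ} (x : Idx n l) : (idxEquiv l σ x).2 = σ x.2 := rfl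

/-- The relabelling of the basis of `gl(Ml|Nl)`. -/
def pairEquiv (l : ℕ) (σ : Equiv.Perm (Fin n)) : Idx n l × Idx n l ≃ Idx n l × Idx n l :=
  (idxEquiv l σ).prodCongr (idxEquiv l σ)

@[simp] lemma pairEquiv_fst {l : ℕ} (x : Idx n l × Idx n l) :
    (pairEquiv l σ x).1 = idxEquiv l σ x.1 := rfl

@[simp] lemma pairEquiv_snd {l : ℕ} (x : Idx n l × Idx n l) :
    (pairEquiv l σ x).2 = idxEquiv l σ x.2 := rfl

/-- The relabelling of the basis of `𝔟`. -/
def bEquiv (l : ℕ) (σ : Equiv.Perm (Fin n)) : BBasis n l ≃ BBasis n l :=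
  (pairEquiv l σ).subtypeEquiv fun _ => Iff.rfl

/-- The relabelling of the basis of `𝔤_{< 0}`. -/
def nEquiv (l : ℕ) (σ : Equiv.Perm (Fin n)) : NBasis n l ≃ NBasis n l :=
  (pairEquiv l σ).subtypeEquiv fun _ => Iff.rfl

@[simp] lemma bEquiv_val {l : ℕ} (x : BBasis n l) : (bEquiv l σ x).1 = pairEquiv l σ x.1 := rfl

@[simp] lemma nEquiv_val {l : ℕ} (x : NBasis n l) : (nEquiv l σ x).1 = pairEquiv l σ x.1 := rfl

lemma glPar_relabel (hσ : ∀ i, p' (σ i) = p i) {l : ℕ} (x : Idx n l × Idx n l) :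
    glPar p' (pairEquiv l σ x) = glPar p x := by
  simp [glPar, hσ]

lemma glPar_relabel_mk (hσ : ∀ i, p' (σ i) = p i) {l : ℕ} (x y : Idx n l) :
    glPar p' (idxEquiv l σ x, idxEquiv l σ y) = glPar p (x, y) :=
  glPar_relabel hσ (x, y)

/-- Stated for coefficients, because the brackets of `𝔟` and the mixed brackets are cut down by
`subtypeDomain`, which only reads off coefficients. -/
lemma glMul_relabel (hσ : ∀ i, p' (σ i) = p i) {l : ℕ} (u v w : Idx n l × Idx n l) :
    glMul p' (pairEquiv l σ u) (pairEquiv l σ v) (pairEquiv l σ w) = glMul p u v w := by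
  have hw : ((idxEquiv l σ u.1, idxEquiv l σ v.2) = pairEquiv l σ w) ↔ (u.1, v.2) = w :=
    (pairEquiv l σ).injective.eq_iff (a := (u.1, v.2))
  by_cases h : u.2 = v.1
  · simp [glMul, h, hσ, Finsupp.single_apply, hw]
  · simp [glMul, h]

lemma kappaForm_relabel (hσ : ∀ i, p' (σ i) = p i) {l : ℕ} (ϰ c : ℂ) (u v : Idx n l × Idx n l) :
    kappaForm p' ϰ c (pairEquiv l σ u) (pairEquiv l σ v) = kappaForm p ϰ c u v := by
  simp [kappaForm, hσ]
  congr

lemma bData_br_relabel (hσ : ∀ i, p' (σ i) = p i) (l : ℕ) (ϰ c : ℂ) (u v : BBasis n l) :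
    (bData p' l ϰ c).br (bEquiv l σ u) (bEquiv l σ v) =
      ((bData p l ϰ c).br u v).mapDomain (bEquiv l σ) := by
  ext w
  obtain ⟨w, rfl⟩ := (bEquiv l σ).surjective w
  rw [Finsupp.mapDomain_apply (bEquiv l σ).injective]
  simp [bData, glBr, glMul_relabel hσ, glPar_relabel hσ]

lemma mixedBr_relabel (hσ : ∀ i, p' (σ i) = p i) {l : ℕ} (u : BBasis n l) (v : NBasis n l) :
    mixedBr p' (bEquiv l σ u) (nEquiv l σ v) = (mixedBr p u v).mapDomain (nEquiv l σ) := by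
  ext w
  obtain ⟨w, rfl⟩ := (nEquiv l σ).surjective w
  rw [Finsupp.mapDomain_apply (nEquiv l σ).injective]
  simp [mixedBr, glMul_relabel hσ, glPar_relabel hσ]

/-- The relabelling of `𝔟`. -/
def bIso (hσ : ∀ i, p' (σ i) = p i) (l : ℕ) (ϰ c : ℂ) : (bData p l ϰ c).Iso (bData p' l ϰ c) where
  toEquiv := bEquiv l σ
  map_par x := glPar_relabel hσ x.1
  map_br := bData_br_relabel hσ l ϰ c
  map_form x y := kappaForm_relabel hσ ϰ c x.1 y.1

/-- The relabelling of `𝔞`. -/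
def aIso (hσ : ∀ i, p' (σ i) = p i) (l : ℕ) (ϰ c : ℂ) : (aData p l ϰ c).Iso (aData p' l ϰ c) where
  toEquiv := (bEquiv l σ).sumCongr (nEquiv l σ)
  map_par
    | .inl u => glPar_relabel hσ u.1
    | .inr v => congrArg (· + 1) (glPar_relabel hσ v.1)
  map_br
    | .inl u, .inl v => by
        change ((bData p' l ϰ c).br (bEquiv l σ u) (bEquiv l σ v)).mapDomain Sum.inl =
          (((bData p l ϰ c).br u v).mapDomain Sum.inl).mapDomain _
        rw [bData_br_relabel hσ, ← Finsupp.mapDomain_comp, ← Finsupp.mapDomain_comp]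
        rfl
    | .inl u, .inr v => by
        change (mixedBr p' (bEquiv l σ u) (nEquiv l σ v)).mapDomain Sum.inr =
          ((mixedBr p u v).mapDomain Sum.inr).mapDomain _
        rw [mixedBr_relabel hσ, ← Finsupp.mapDomain_comp, ← Finsupp.mapDomain_comp]
        rfl
    | .inr v, .inl u => by
        change -(ksign ((glPar p' (pairEquiv l σ v.1) + 1) * glPar p' (pairEquiv l σ u.1)) •
            (mixedBr p' (bEquiv l σ u) (nEquiv l σ v)).mapDomain Sum.inr) =
          (-(ksign ((glPar p v.1 + 1) * glPar p u.1) •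
            (mixedBr p u v).mapDomain Sum.inr)).mapDomain _
        rw [mixedBr_relabel hσ, glPar_relabel hσ, glPar_relabel hσ, ← Finsupp.mapDomain_comp,
          ← neg_smul, ← neg_smul, Finsupp.mapDomain_smul, ← Finsupp.mapDomain_comp]
        rfl
    | .inr _, .inr _ => Finsupp.mapDomain_zero.symm
  map_form
    | .inl u, .inl v => kappaForm_relabel hσ ϰ c u.1 v.1
    | .inl _, .inr _ => rfl
    | .inr _, .inl _ => rfl
    | .inr _, .inr _ => rfl

/-! ### The differential and its kernel under relabelling -/

lemma affMap_bMode (hσ : ∀ i, p' (σ i) = p i) {l : ℕ} (ϰ c : ℂ) (x y : Idx n l) (m : ℤ) :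
    affMap (bIso hσ l ϰ c).hom (bMode p l ϰ c x y m) =
      bMode p' l ϰ c (idxEquiv l σ x) (idxEquiv l σ y) m := by
  by_cases h : y.1 ≤ x.1
  · have h' : (idxEquiv l σ y).1 ≤ (idxEquiv l σ x).1 := h
    rw [bMode, bMode, dif_pos h, dif_pos h', affMap_mode]
    rfl
  · have h' : ¬ (idxEquiv l σ y).1 ≤ (idxEquiv l σ x).1 := h
    rw [bMode, bMode, dif_neg h, dif_neg h', map_zero]

lemma affMap_eMode (hσ : ∀ i, p' (σ i) = p i) {l : ℕ} (ϰ c : ℂ) (x y : Idx n l) (m : ℤ) :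
    affMap (aIso hσ l ϰ c).hom (eMode p l ϰ c x y m) =
      eMode p' l ϰ c (idxEquiv l σ x) (idxEquiv l σ y) m := by
  by_cases h : y.1 ≤ x.1
  · have h' : (idxEquiv l σ y).1 ≤ (idxEquiv l σ x).1 := h
    rw [eMode, eMode, dif_pos h, dif_pos h', affMap_mode]
    rfl
  · have h' : ¬ (idxEquiv l σ y).1 ≤ (idxEquiv l σ x).1 := h
    rw [eMode, eMode, dif_neg h, dif_neg h', map_zero]

lemma affMap_ghostMode (hσ : ∀ i, p' (σ i) = p i) {l : ℕ} (ϰ c : ℂ) (x y : Idx n l) (m : ℤ) :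
    affMap (aIso hσ l ϰ c).hom (ghostMode p l ϰ c x y m) =
      ghostMode p' l ϰ c (idxEquiv l σ x) (idxEquiv l σ y) m := by
  by_cases h : y.1 < x.1
  · have h' : (idxEquiv l σ y).1 < (idxEquiv l σ x).1 := h
    rw [ghostMode, ghostMode, dif_pos h, dif_pos h', affMap_mode]
    rfl
  · have h' : ¬ (idxEquiv l σ y).1 < (idxEquiv l σ x).1 := h
    rw [ghostMode, ghostMode, dif_neg h, dif_neg h', map_zero]

/-- The signs involve only parities, the sums over `z` are reindexed by `idxEquiv l σ`, and the
linear terms shift only the block, which the relabelling fixes. -/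
lemma brstGen_relabel (hσ : ∀ i, p' (σ i) = p i) (l : ℕ) (ϰ c : ℂ) (b : BBasis n l ⊕ NBasis n l) :
    vacEquiv (aIso hσ l ϰ c) (brstGen p l ϰ c b) =
      brstGen p' l ϰ c ((aIso hσ l ϰ c).toEquiv b) := by
  match b with
  | .inl ⟨(x, y), h⟩ =>
    have h' : (idxEquiv l σ x, idxEquiv l σ y).2.1 ≤ (idxEquiv l σ x, idxEquiv l σ y).1.1 := h
    change _ = brstGen p' l ϰ c (.inl ⟨(idxEquiv l σ x, idxEquiv l σ y), h'⟩)
    rw [vacEquiv_apply, brstGen, brstGen, vacMap_smul_aff, vacMap_vacuum]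
    congr 1
    simp only [map_add, map_sub, map_sum, map_smul, map_mul, affMap_eMode hσ,
      affMap_ghostMode hσ, apply_ite (affMap (aIso hσ l ϰ c).hom), map_zero]
    refine congrArg₂ (· + ·) (congrArg₂ (· - ·)
      (Fintype.sum_equiv (idxEquiv l σ) _ _ fun z => ?_)
      (Fintype.sum_equiv (idxEquiv l σ) _ _ fun z => ?_)) ?_
    · simp only [glPar_relabel_mk hσ, idxEquiv_snd, hσ]
    · simp only [glPar_relabel_mk hσ, idxEquiv_snd, hσ]
    · rw [idxEquiv_snd, hσ]
      rfl
  | .inr ⟨(x, y), h⟩ =>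
    have h' : (idxEquiv l σ x, idxEquiv l σ y).2.1 < (idxEquiv l σ x, idxEquiv l σ y).1.1 := h
    change _ = brstGen p' l ϰ c (.inr ⟨(idxEquiv l σ x, idxEquiv l σ y), h'⟩)
    rw [vacEquiv_apply, brstGen, brstGen, vacMap_smul_aff, vacMap_vacuum]
    congr 1
    simp only [map_neg, map_sum, map_smul, map_mul, affMap_ghostMode hσ]
    refine congrArg _ (Fintype.sum_equiv (idxEquiv l σ) _ _ fun z => ?_)
    simp only [glPar_relabel_mk hσ, idxEquiv_snd, hσ]

/-- The vacuum, the parts, the translation, the products and the prescribed values on generators are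
all carried over by `vacEquiv`, so each axiom transfers to the conjugate. -/
lemma IsBRST.relabel (hσ : ∀ i, p' (σ i) = p i)
    {l : ℕ} {ϰ c : ℂ}
    {Q : VacMod (aData p l ϰ c) →ₗ[ℂ] VacMod (aData p l ϰ c)} (hQ : IsBRST p l ϰ c Q) :
    IsBRST p' l ϰ c ((vacEquiv (aIso hσ l ϰ c)).conj Q) := by
  set e := aIso hσ l ϰ c with he
  have hconj : ∀ v, (vacEquiv e).conj Q (vacEquiv e v) = vacEquiv e (Q v) := fun v => by
    rw [LinearEquiv.conj_apply_apply, LinearEquiv.symm_apply_apply]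
  refine ⟨?_, ?_, ?_, ?_, ?_⟩
  · rw [← vacEquiv_vacuum e, hconj, hQ.map_vac, map_zero]
  · rintro ε _ ⟨v, hv, rfl⟩
    obtain ⟨v, rfl⟩ := (vacEquiv e).surjective v
    rw [hconj, vacEquiv_mem_part]
    exact hQ.odd ε ⟨v, (vacEquiv_mem_part e).1 hv, rfl⟩
  · intro u
    obtain ⟨u, rfl⟩ := (vacEquiv e).surjective u
    rw [← vacEquiv_trans, hconj, hconj, hQ.map_trans, vacEquiv_trans]
  · intro ε m u v hu
    obtain ⟨u, rfl⟩ := (vacEquiv e).surjective u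
    obtain ⟨v, rfl⟩ := (vacEquiv e).surjective v
    rw [← vacEquiv_prod, hconj, hconj, hconj, hQ.leibniz ε m u v ((vacEquiv_mem_part e).1 hu),
      map_add, map_smul, vacEquiv_prod, vacEquiv_prod]
  · intro b
    obtain ⟨b, rfl⟩ := e.toEquiv.surjective b
    rw [← vacEquiv_vacuum e, ← vacEquiv_mode, hconj, hQ.map_gen, brstGen_relabel hσ]

lemma isBRST_relabel_iff (hσ : ∀ i, p' (σ i) = p i) {l : ℕ} {ϰ c : ℂ}
    (Q : VacMod (aData p l ϰ c) →ₗ[ℂ] VacMod (aData p l ϰ c)) :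
    IsBRST p' l ϰ c ((vacEquiv (aIso hσ l ϰ c)).conj Q) ↔ IsBRST p l ϰ c Q := by
  refine ⟨fun h => ?_, IsBRST.relabel hσ⟩
  have hσ' : ∀ i, p (σ.symm i) = p' i := fun i => by rw [← hσ, Equiv.apply_symm_apply]
  -- Relabelling by `σ.symm` is by definition the inverse of relabelling by `σ`.
  have h' : IsBRST p l ϰ c ((vacEquiv (aIso hσ l ϰ c)).symm.conj
      ((vacEquiv (aIso hσ l ϰ c)).conj Q)) := h.relabel hσ'
  rwa [conj_symm_conj] at h'

/-- If there is a unique differential for `p`, its conjugate satisfies the conditions that determine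
the one for `p'`. Otherwise both sides are the default 0. -/
lemma brst_relabel (hσ : ∀ i, p' (σ i) = p i) (l : ℕ) (ϰ c : ℂ) :
    brst p' l ϰ c = (vacEquiv (aIso hσ l ϰ c)).conj (brst p l ϰ c) := by
  have hiff : (∃! Q, IsBRST p' l ϰ c Q) ↔ ∃! Q, IsBRST p l ϰ c Q :=
    ((vacEquiv (aIso hσ l ϰ c)).conj.toEquiv.existsUnique_congr
      fun {Q} => (isBRST_relabel_iff hσ Q).symm).symm
  by_cases h : ∃! Q, IsBRST p l ϰ c Q
  · have h' := hiff.2 h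
    rw [brst, dif_pos h', brst, dif_pos h]
    exact h'.unique h'.choose_spec.1 (h.choose_spec.1.relabel hσ)
  · rw [brst, dif_neg (mt hiff.1 h), brst, dif_neg h, map_zero]

lemma mem_wSub_relabel (hσ : ∀ i, p' (σ i) = p i) (l : ℕ) (ϰ c : ℂ) (v : VacMod (bData p l ϰ c)) :
    vacEquiv (bIso hσ l ϰ c) v ∈ wSub p' l ϰ c ↔ v ∈ wSub p l ϰ c := by
  have hincl : vacMap (incl p' l ϰ c) (vacEquiv (bIso hσ l ϰ c) v) =
      vacEquiv (aIso hσ l ϰ c) (vacMap (incl p l ϰ c) v) := by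
    -- The diagonal of the square formed by the two inclusions and the two relabellings; both paths
    -- agree with it on basis elements.
    let f : (bData p l ϰ c).Hom (aData p' l ϰ c) :=
      { toFun := fun b => Sum.inl (bEquiv l σ b)
        map_par := (bIso hσ l ϰ c).map_par
        map_br := fun a b => (aIso hσ l ϰ c).map_br (.inl a) (.inl b) |>.trans
          (Finsupp.mapDomain_comp (f := Sum.inl) (v := (bData p l ϰ c).br a b)).symm
        map_form := (bIso hσ l ϰ c).map_form }
    rw [vacEquiv_apply, vacEquiv_apply, vacMap_vacMap _ _ f fun _ => rfl,
      vacMap_vacMap _ _ f fun _ => rfl]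
  simp only [wSub, LinearMap.mem_ker, LinearMap.comp_apply]
  rw [hincl, brst_relabel hσ, LinearEquiv.conj_apply_apply, LinearEquiv.symm_apply_apply,
    LinearEquiv.map_eq_zero_iff]

/-! ### Relabelling the generators -/

lemma tauMul_relabel (hσ : ∀ i, p' (σ i) = p i) (l : ℕ) (ϰ c : ℂ)
    (P : ℕ → VacMod (bData p l ϰ c)) (d : ℕ) :
    vacEquiv (bIso hσ l ϰ c) (tauMul p l ϰ c P d) =
      tauMul p' l ϰ c (fun d => vacEquiv (bIso hσ l ϰ c) (P d)) d := by
  cases d <;> simp [tauMul, vacEquiv_trans]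

lemma entryMul_relabel (hσ : ∀ i, p' (σ i) = p i) {l : ℕ} (ϰ c : ℂ) (i j : Fin n) (r s : Fin l)
    (P : ℕ → VacMod (bData p l ϰ c)) (d : ℕ) :
    vacEquiv (bIso hσ l ϰ c) (entryMul p l ϰ c i j r s P d) =
      entryMul p' l ϰ c (σ i) (σ j) r s (fun d => vacEquiv (bIso hσ l ϰ c) (P d)) d := by
  have hmode : vacEquiv (bIso hσ l ϰ c) (bMode p l ϰ c (r, j) (s, i) (-1) • P d) =
      bMode p' l ϰ c (r, σ j) (s, σ i) (-1) • vacEquiv (bIso hσ l ϰ c) (P d) := by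
    rw [vacEquiv_apply, vacMap_smul_aff, affMap_bMode hσ]
    rfl
  simp only [entryMul, map_sub, map_add, hmode, σ.injective.eq_iff,
    apply_ite (vacEquiv (bIso hσ l ϰ c)), map_zero, tauMul_relabel hσ]

/-- The permutation `π` of the determinant moves blocks, while `σ` acts inside them, so the two do
not interact. The sum over the intermediate index is reindexed by `σ`, which preserves its signs. -/
lemma colProd_relabel (hσ : ∀ i, p' (σ i) = p i) {l : ℕ} (ϰ c : ℂ)
    (π : Equiv.Perm (Fin l)) (ss : List (Fin l))
    (i j : Fin n) (d : ℕ) :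
    vacEquiv (bIso hσ l ϰ c) (colProd p l ϰ c π ss i j d) =
      colProd p' l ϰ c π ss (σ i) (σ j) d := by
  induction ss generalizing i d with
  | nil => simp [colProd, apply_ite (vacEquiv (bIso hσ l ϰ c))]
  | cons s ss ih =>
    simp only [colProd, map_sum, map_smul, entryMul_relabel hσ, ih]
    exact Fintype.sum_equiv σ _ _ fun x => by rw [hσ, hσ, hσ]

lemma cdet_relabel (hσ : ∀ i, p' (σ i) = p i) (l : ℕ) (ϰ c : ℂ) (i j : Fin n) (d : ℕ) :
    vacEquiv (bIso hσ l ϰ c) (cdet p l ϰ c i j d) = cdet p' l ϰ c (σ i) (σ j) d := by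
  simp only [cdet, map_sum, map_smul, colProd_relabel hσ]

end Relabel

/-! ### Permutations relating two parity sequences -/

/-- The positions of `+1` are equinumerous, and a bijection between two subsets of a finite set
extends to a permutation, which then also matches the complements, the positions of `-1`. -/
lemma exists_perm_of_isParitySeq {M N : ℕ} {ς ς' : Fin (M + N) → ℤˣ} (h : IsParitySeq M N ς)
    (h' : IsParitySeq M N ς') : ∃ σ : Equiv.Perm (Fin (M + N)), ∀ i, ς' (σ i) = ς i := by
  have e : {i // ς i = 1} ≃ {i // ς' i = 1} := Fintype.equivOfCardEq (by
    rw [Fintype.card_subtype, Fintype.card_subtype]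
    exact h.trans h'.symm)
  refine ⟨e.extendSubtype, fun i => ?_⟩
  rcases Int.units_eq_one_or (ς i) with hi | hi
  · rw [hi]
    exact e.extendSubtype_mem i hi
  · have := e.extendSubtype_not_mem i (by rw [hi]; decide)
    rw [hi]
    exact (Int.units_eq_one_or _).resolve_left this

end RectW

end

theorem proposition4p1 (M N l : ℕ) (hl : 1 ≤ l) (k c : ℂ) :
    (∀ ς ς' : Fin (M + N) → ℤˣ, RectW.IsParitySeq M N ς → RectW.IsParitySeq M N ς' →
      Nonempty ((RectW.wAlgebra M N l k c ς).Iso (RectW.wAlgebra M N l k c ς'))) ∧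
    (∀ ς ς' : Fin (M + N) → ℤˣ, RectW.IsParitySeq M N ς → RectW.IsParitySeq M N ς' →
      ∀ σ : Equiv.Perm (Fin (M + N)), (∀ i, ς' (σ i) = ς i) →
      ∃ (φ : (RectW.wAlgebra M N l k c ς).Iso (RectW.wAlgebra M N l k c ς'))
        (Φ : (RectW.vertexB M N l k c ς).Iso (RectW.vertexB M N l k c ς')),
        (∀ w : RectW.wSpace M N l k c ς,
          (φ.toLinearEquiv w : RectW.VB M N l k c ς') =
            Φ.toLinearEquiv (w : RectW.VB M N l k c ς)) ∧
        ∀ r : ℕ, 1 ≤ r → r ≤ l → ∀ i j : Fin (M + N),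
          Φ.toLinearEquiv (RectW.wGen M N l k c ς r i j) =
            RectW.wGen M N l k c ς' r (σ i) (σ j)) := by
  have main : ∀ ς ς' : Fin (M + N) → ℤˣ,
      ∀ σ : Equiv.Perm (Fin (M + N)), (∀ i, ς' (σ i) = ς i) →
      ∃ (φ : (RectW.wAlgebra M N l k c ς).Iso (RectW.wAlgebra M N l k c ς'))
        (Φ : (RectW.vertexB M N l k c ς).Iso (RectW.vertexB M N l k c ς')),
        (∀ w : RectW.wSpace M N l k c ς,
          (φ.toLinearEquiv w : RectW.VB M N l k c ς') =
            Φ.toLinearEquiv (w : RectW.VB M N l k c ς)) ∧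
        ∀ r : ℕ, 1 ≤ r → r ≤ l → ∀ i j : Fin (M + N),
          Φ.toLinearEquiv (RectW.wGen M N l k c ς r i j) =
            RectW.wGen M N l k c ς' r (σ i) (σ j) := by
    intro ς ς' σ h
    have hσ : ∀ i, RectW.parity ς' (σ i) = RectW.parity ς i := fun i => by
      simp [RectW.parity, h]
    let Φ : (RectW.vertexB M N l k c ς).Iso (RectW.vertexB M N l k c ς') :=
      RectW.affineIso (RectW.bIso hσ l (RectW.kappaConst M N l k) c)
    -- The indices in `cdet_relabel` appear as `j i` because `U^(r)_{ij}` comes from the component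
    -- `𝔗_{ji}`.
    exact ⟨Φ.restrict _ _ (RectW.mem_wSub_relabel hσ l _ c), Φ, fun _ => rfl,
      fun r _ _ i j => RectW.cdet_relabel hσ l _ c j i (l - r)⟩
  refine ⟨fun ς ς' hς hς' => ?_, fun ς ς' _ _ σ hσ => main ς ς' σ hσ⟩
  obtain ⟨σ, hσ⟩ := RectW.exists_perm_of_isParitySeq hς hς'
  obtain ⟨φ, -⟩ := main ς ς' σ hσ
  exact ⟨φ⟩
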